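/- Let $p,a,d$ be integers with $a\ge 3$, $d>0$, $\gcd(a,d)=1$ and $0\le p\le\lfloor a/2\rfloor$. For an integer $n\ge 0$ let $d(n;a,a+d,a+2d)$ be the number of triples $(x_1,x_2,x_3)$ of non-negative integers with $a x_1+(a+d)x_2+(a+2d)x_3=n$, let $$S_p=S_p(a,a+d,a+2d)=\{n\in\mathbb Z_{\ge 0}: d(n;a,a+d,a+2d)>p\},$$ and let $H_p(a,a+d,a+2d;x)=\sum_{s\in S_p}x^s$ be its $p$-Hilbert series. Then, both as an identity of formal power series (over $\mathbb Q$) and as an identity of convergent series for every complex $x$ with $|x|<1$, the following holds. If $a$ is odd, then $$H_p(a,a+d,a+2d;x)=\frac{1}{1-x^a}\left(\frac{x^{\frac{(a-1)(a+2d)}{2}+pa+d}(1-x^{2pd})}{1-x^d}+\frac{x^{2p(a+d)}\left(1+x^{a+d}-x^{(\frac{a+1}{2}-p)(a+2d)}-x^{a+d+(\frac{a-1}{2}-p)(a+2d)}\right)}{1-x^{a+2d}}\right).$$ If $a$ is even, then $$H_p(a,a+d,a+2d;x)=\frac{x^{a+d}+1}{1-x^a}\left(\frac{x^{\frac{a(a+2d)}{2}+(p-1)a}(1-x^{2pd})}{1-x^{2d}}+\frac{x^{2p(a+d)}\left(1-x^{(\frac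 a2-p)(a+2d)}\right)}{1-x^{a+2d}}\right).$$ -/

import Mathlib

/-- The denumerant `d(n; a₁, …, a_k)`: the number of tuples of non-negative integers
`(x₁, …, x_k)` with `a₁ x₁ + ⋯ + a_k x_k = n`. (For positive `aᵢ` this set of tuples is finite.) -/
noncomputable def denumerant {k : ℕ} (A : Fin k → ℕ) (n : ℕ) : ℕ :=
  Set.ncard {x : Fin k → ℕ | ∑ i, A i * x i = n}

/-- The `p`-numerical semigroup `S_p(A)`: the non-negative integers with more than `p`
representations by the generators `A`. -/
def pSemigroup {k : ℕ} (p : ℕ) (A : Fin k → ℕ) : Set ℕ :=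
  {n : ℕ | p < denumerant A n}

open Classical in
/-- The `p`-Hilbert series `∑_{s ∈ S_p(A)} X ^ s` as a formal power series. -/
noncomputable def pHilbertSeries {k : ℕ} (p : ℕ) (A : Fin k → ℕ) : PowerSeries ℚ :=
  PowerSeries.mk fun n => if n ∈ pSemigroup p A then 1 else 0

open Finset

/-! ### Bounding the denumerant of three generators by the values of the last coordinate -/

/-! A solution satisfies `n = a * (x + y + z) + d * (y + 2 * z)`, so it is fixed by its length,
weight `y + 2 * z` and `z`. Write `n = a * s + d * r` with `r < a`; by coprimality the weights are
`r + a * j`, with lengths `s - d * j`. If `2 * p ≤ r`, weight `r` alone supplies `p + 1` values of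
`z` exactly from `s = p + ⌈r/2⌉` on. If `r < 2 * p`, it supplies at most `r / 2 + 1 ≤ p`, and weight
`r + a` must supply the rest. This threshold is `aperyLevel`; its two sides are
`lt_denumerant_of_level_le` and `denumerant_le_of_lt_level`. Hence the semigroup is a disjoint union
of progressions of difference `a` starting at `aperyElt`, and the series is `∑ x ^ aperyElt` over `1
- x ^ a`. Splitting at `r = 2 * p`, and by parity where needed, leaves geometric sums. -/

theorem setOf_sum_eq_finite {a b c : ℕ} (ha : 0 < a) (hb : 0 < b) (hc : 0 < c) (n : ℕ) :
    {x : Fin 3 → ℕ | ∑ i, ![a, b, c] i * x i = n}.Finite := by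
  refine (Set.finite_Iic (fun _ : Fin 3 => n)).subset ?_
  intro x hx
  simp only [Set.mem_ofPred_eq, Fin.sum_univ_three, Matrix.cons_val_zero, Matrix.cons_val_one,
    Matrix.cons_val] at hx
  have h0 := Nat.le_mul_of_pos_left (x 0) ha
  have h1 := Nat.le_mul_of_pos_left (x 1) hb
  have h2 := Nat.le_mul_of_pos_left (x 2) hc
  rw [Set.mem_Iic, Pi.le_def]
  intro i
  fin_cases i <;> simp <;> omega

theorem card_le_denumerant {a b c : ℕ} (ha : 0 < a) (hb : 0 < b) (hc : 0 < c) {n : ℕ}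
    (T : Finset ℕ) (hT : ∀ z ∈ T, ∃ x y : ℕ, a * x + b * y + c * z = n) :
    T.card ≤ denumerant ![a, b, c] n := by
  have hfin := setOf_sum_eq_finite ha hb hc n
  have hsub : (T : Set ℕ) ⊆ (fun x : Fin 3 → ℕ => x 2) ''
      {x : Fin 3 → ℕ | ∑ i, ![a, b, c] i * x i = n} := by
    intro z hz
    obtain ⟨x, y, h⟩ := hT z hz
    exact ⟨![x, y, z], by simpa [Fin.sum_univ_three] using h, by simp⟩
  calc T.card = (T : Set ℕ).ncard := (Set.ncard_coe_finset T).symm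
    _ ≤ _ := Set.ncard_le_ncard hsub (hfin.image _)
    _ ≤ _ := Set.ncard_image_le hfin

theorem denumerant_le_card {a b c : ℕ} {n : ℕ} (T : Finset ℕ)
    (hT : ∀ x y z : ℕ, a * x + b * y + c * z = n → z ∈ T)
    (hinj : ∀ x y x' y' z : ℕ, a * x + b * y + c * z = n → a * x' + b * y' + c * z = n →
      x = x' ∧ y = y') :
    denumerant ![a, b, c] n ≤ T.card := by
  rw [← Set.ncard_coe_finset T]
  refine Set.ncard_le_ncard_of_injOn (fun x : Fin 3 → ℕ => x 2) ?_ ?_ T.finite_toSet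
  · intro x hx
    exact hT (x 0) (x 1) (x 2) (by simpa [Fin.sum_univ_three] using hx)
  · intro x hx y hy hxy
    simp only [Set.mem_ofPred_eq, Fin.sum_univ_three, Matrix.cons_val_zero, Matrix.cons_val_one,
      Matrix.cons_val] at hx hy hxy
    rw [← hxy] at hy
    obtain ⟨h0, h1⟩ := hinj _ _ _ _ _ hx hy
    ext i
    fin_cases i
    exacts [h0, h1, hxy]

/-! ### The `p`-Apéry set of `a, a + d, a + 2d` -/

/-- The number `s` for which `a * s + d * r` is the least element of the `p`-numerical semigroup
of `a, a + d, a + 2d` congruent to `d * r` modulo `a`. -/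
def aperyLevel (p a d r : ℕ) : ℕ :=
  if 2 * p ≤ r then p + (r + 1) / 2 else p + d + ((r + a + 1) / 2 - r / 2 - 1)

/-- The least element of the `p`-numerical semigroup of `a, a + d, a + 2d` congruent to `d * r`
modulo `a`. -/
def aperyElt (p a d r : ℕ) : ℕ := a * aperyLevel p a d r + d * r

/-- A representation with weight `t = y + 2z` and length `s`. -/
theorem exists_repr_of_weight {a d s t z : ℕ} (h1 : 2 * z ≤ t) (h2 : t ≤ s + z) :
    ∃ x y : ℕ, a * x + (a + d) * y + (a + 2 * d) * z = a * s + d * t := by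
  refine ⟨s + z - t, t - 2 * z, ?_⟩
  zify [h1, h2]
  ring

theorem lt_denumerant_of_level_le {p a d r s : ℕ} (ha : 3 ≤ a) (hp : p ≤ a / 2)
    (hs : aperyLevel p a d r ≤ s) :
    p < denumerant ![a, a + d, a + 2 * d] (a * s + d * r) := by
  unfold aperyLevel at hs
  split_ifs at hs with hr
  · have := card_le_denumerant (a := a) (b := a + d) (c := a + 2 * d) (n := a * s + d * r)
      (by omega) (by omega) (by omega) (Icc (r / 2 - p) (r / 2)) (fun z hz => by
        rw [mem_Icc] at hz
        exact exists_repr_of_weight (by omega) (by omega))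
    rw [Nat.card_Icc] at this
    omega
  -- The first interval holds the `z` of weight `r`, the second those of weight `r + a`; `p ≤ a / 2`
  -- keeps them apart.
  · have hdisj : Disjoint (Icc 0 (r / 2)) (Icc ((r + a) / 2 + r / 2 + 1 - p) ((r + a) / 2)) := by
      rw [disjoint_left]
      intro z hz hz'
      rw [mem_Icc] at hz hz'
      omega
    have := card_le_denumerant (a := a) (b := a + d) (c := a + 2 * d) (n := a * s + d * r)
      (by omega) (by omega) (by omega)
      (Icc 0 (r / 2) ∪ Icc ((r + a) / 2 + r / 2 + 1 - p) ((r + a) / 2)) (fun z hz => by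
        rw [mem_union, mem_Icc, mem_Icc] at hz
        rcases hz with hz | hz
        · exact exists_repr_of_weight (by omega) (by omega)
        · have hds : d ≤ s := by omega
          have : a * s + d * r = a * (s - d) + d * (r + a) := by
            zify [hds]
            ring
          rw [this]
          exact exists_repr_of_weight (by omega) (by omega))
    rw [card_union_of_disjoint hdisj, Nat.card_Icc, Nat.card_Icc] at this
    omega

/-- The weights `y + 2z` of the representations of a number differ by multiples of `a`. -/
theorem exists_weight_eq {a d r x y z : ℕ} {s : ℤ} (had : Nat.gcd a d = 1)
    (hr : r < a) (h : ((a * x + (a + d) * y + (a + 2 * d) * z : ℕ) : ℤ) = a * s + d * r) :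
    ∃ j : ℕ, y + 2 * z = r + a * j ∧ (x + y + z : ℤ) = s - d * j := by
  have hcop : IsCoprime (a : ℤ) (d : ℤ) := Nat.isCoprime_iff_coprime.mpr had
  have heq : (d : ℤ) * (y + 2 * z - r) = a * (s - (x + y + z)) := by
    push_cast at h
    linarith
  obtain ⟨j, hj⟩ := hcop.dvd_of_dvd_mul_left (Dvd.intro _ heq.symm)
  have hj0 : 0 ≤ j := by
    by_contra! hneg
    have : (a : ℤ) * j ≤ a * (-1) := mul_le_mul_of_nonneg_left (by omega) (by omega)
    omega
  lift j to ℕ using hj0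
  refine ⟨j, by zify; linarith, ?_⟩
  have ha : (a : ℤ) ≠ 0 := by omega
  apply mul_left_cancel₀ ha
  rw [hj] at heq
  linarith

theorem denumerant_le_of_lt_level {p a d r n : ℕ} {s : ℤ} (hd : 0 < d)
    (had : Nat.gcd a d = 1) (hp : p ≤ a / 2) (hr : r < a) (hn : (n : ℤ) = a * s + d * r)
    (hs : s < aperyLevel p a d r) :
    denumerant ![a, a + d, a + 2 * d] n ≤ p := by
  have hw : ∀ x y z : ℕ, a * x + (a + d) * y + (a + 2 * d) * z = n →
      ((y + 2 * z = r ∧ (x + y + z : ℤ) = s) ∨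
        (y + 2 * z = r + a ∧ (x + y + z : ℤ) = s - d) ∧ r < 2 * p) := by
    intro x y z h
    obtain ⟨j, h1, h2⟩ := exists_weight_eq had hr (h ▸ hn)
    rcases j with _ | _ | j
    · left
      simp at h1 h2
      omega
    · right
      simp at h1 h2
      refine ⟨⟨by omega, by omega⟩, ?_⟩
      by_contra hcon
      rw [aperyLevel, if_pos (by omega)] at hs
      omega
    -- Length is at least half the weight, so `j ≥ 2` would need `s ≥ 2 * d + a + r / 2`, beyond the
    -- level.
    · exfalso
      have e1 : a * (j + 1 + 1) = a * j + 2 * a := by ring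
      have e2 : (d : ℤ) * ((j + 1 + 1 : ℕ) : ℤ) = ((d * j : ℕ) : ℤ) + 2 * d := by
        push_cast
        ring
      rw [e1] at h1
      rw [e2] at h2
      unfold aperyLevel at hs
      split_ifs at hs <;> omega
  -- Below the level, weights `r` and `r + a` cannot share a value of `z`.
  have hinj : ∀ x y x' y' z : ℕ, a * x + (a + d) * y + (a + 2 * d) * z = n →
      a * x' + (a + d) * y' + (a + 2 * d) * z = n → x = x' ∧ y = y' := by
    intro x y x' y' z h h'
    have h1 := hw _ _ _ h
    have h2 := hw _ _ _ h'
    unfold aperyLevel at hs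
    split_ifs at hs <;> omega
  unfold aperyLevel at hs
  split_ifs at hs with hr2
  · refine (denumerant_le_card (Ioc (r / 2 - p) (r / 2)) ?_ hinj).trans ?_
    · intro x y z h
      have := hw _ _ _ h
      rw [mem_Ioc]
      omega
    · rw [Nat.card_Ioc]
      omega
  · refine (denumerant_le_card
      (Icc 0 (r / 2) ∪ Icc ((r + a) / 2 + r / 2 + 2 - p) ((r + a) / 2)) ?_ hinj).trans ?_
    · intro x y z h
      have := hw _ _ _ h
      rw [mem_union, mem_Icc, mem_Icc]
      omega
    · refine (card_union_le _ _).trans ?_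
      rw [Nat.card_Icc, Nat.card_Icc]
      omega

theorem exists_residue {a d : ℕ} (ha : 0 < a) (had : Nat.gcd a d = 1) (n : ℕ) :
    ∃ r < a, ∃ s : ℤ, (n : ℤ) = a * s + d * r := by
  obtain ⟨u, v, huv⟩ : IsCoprime (a : ℤ) (d : ℤ) := Nat.isCoprime_iff_coprime.mpr had
  have ha' : (0 : ℤ) < a := by omega
  have h0 := Int.emod_nonneg (v * n) ha'.ne'
  have h1 := Int.emod_lt_of_pos (v * n) ha'
  refine ⟨(v * n % a).toNat, by omega, u * n + d * (v * n / a), ?_⟩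
  rw [Int.toNat_of_nonneg h0]
  have h2 := Int.emod_add_mul_ediv (v * n) a
  linear_combination (-(n : ℤ)) * huv - d * h2

/-- The residue classes `d * r` modulo `a` with `r < a` are distinct. -/
theorem residue_unique {a d r r' : ℕ} {s s' : ℤ} (had : Nat.gcd a d = 1) (hr : r < a)
    (hr' : r' < a) (h : (a * s + d * r : ℤ) = a * s' + d * r') : r = r' := by
  have hcop : IsCoprime (a : ℤ) (d : ℤ) := Nat.isCoprime_iff_coprime.mpr had
  have heq : (d : ℤ) * (r' - r) = a * (s - s') := by linarith
  have hdvd := hcop.dvd_of_dvd_mul_left (Dvd.intro _ heq.symm)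
  have := Int.eq_zero_of_abs_lt_dvd hdvd (abs_lt.mpr ⟨by omega, by omega⟩)
  omega

theorem mem_pSemigroup_iff {p a d : ℕ} (ha : 3 ≤ a) (hd : 0 < d) (had : Nat.gcd a d = 1)
    (hp : p ≤ a / 2) (n : ℕ) :
    n ∈ pSemigroup p ![a, a + d, a + 2 * d] ↔
      ∃ r < a, aperyElt p a d r ≤ n ∧ a ∣ n - aperyElt p a d r := by
  constructor
  · intro hn
    obtain ⟨r, hr, s, hs⟩ := exists_residue (by omega) had n
    have hle : (aperyLevel p a d r : ℤ) ≤ s := by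
      by_contra! hlt
      exact absurd hn (not_lt.mpr (denumerant_le_of_lt_level hd had hp hr hs hlt))
    obtain ⟨k, hk⟩ := Int.le.dest hle
    have hn' : n = aperyElt p a d r + a * k := by
      zify
      rw [hs, ← hk, aperyElt]
      push_cast
      ring
    exact ⟨r, hr, by omega, by rw [hn', Nat.add_sub_cancel_left]; exact dvd_mul_right _ _⟩
  · rintro ⟨r, -, hle, k, hk⟩
    have hn : n = a * (aperyLevel p a d r + k) + d * r := by
      rw [mul_add, ← hk]
      unfold aperyElt at hle ⊢
      omega
    rw [hn]
    exact lt_denumerant_of_level_le ha hp (Nat.le_add_right _ _)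

theorem aperyElt_residue_unique {p a d n r r' : ℕ} (had : Nat.gcd a d = 1) (hr : r < a)
    (hr' : r' < a) (h : aperyElt p a d r ≤ n ∧ a ∣ n - aperyElt p a d r)
    (h' : aperyElt p a d r' ≤ n ∧ a ∣ n - aperyElt p a d r') : r = r' := by
  obtain ⟨h1, k, hk⟩ := h
  obtain ⟨h1', k', hk'⟩ := h'
  refine residue_unique (s := aperyLevel p a d r + k) (s' := aperyLevel p a d r' + k')
    had hr hr' ?_
  have e : aperyElt p a d r + a * k = aperyElt p a d r' + a * k' := by omega
  unfold aperyElt at e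
  zify at e
  linarith

/-- Values in a general `R` let this decomposition serve both the formal and the complex series. -/
theorem indicator_pSemigroup {R : Type*} [AddCommMonoid R] {p a d : ℕ} (ha : 3 ≤ a) (hd : 0 < d)
    (had : Nat.gcd a d = 1) (hp : p ≤ a / 2) (f : ℕ → R) (n : ℕ) :
    (pSemigroup p ![a, a + d, a + 2 * d]).indicator f n =
      ∑ r ∈ range a, if aperyElt p a d r ≤ n ∧ a ∣ n - aperyElt p a d r then f n else 0 := by
  by_cases hn : n ∈ pSemigroup p ![a, a + d, a + 2 * d]
  · rw [Set.indicator_of_mem hn]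
    obtain ⟨r, hr, h⟩ := (mem_pSemigroup_iff ha hd had hp n).mp hn
    rw [sum_eq_single r, if_pos h]
    · intro r' hr' hne
      exact if_neg fun h' => hne (aperyElt_residue_unique had (mem_range.mp hr') hr h' h)
    · exact fun h' => absurd (mem_range.mpr hr) h'
  · rw [Set.indicator_of_notMem hn]
    refine (sum_eq_zero fun r hr => if_neg fun h => hn ?_).symm
    exact (mem_pSemigroup_iff ha hd had hp n).mpr ⟨r, mem_range.mp hr, h⟩

/-! ### The Hilbert series in terms of the Apéry set -/

theorem one_sub_X_pow_mul_inv {m : ℕ} (hm : 0 < m) :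
    (1 - PowerSeries.X ^ m : PowerSeries ℚ) * (1 - PowerSeries.X ^ m)⁻¹ = 1 :=
  PowerSeries.mul_inv_cancel _ (by simp [hm.ne'])

theorem mk_dvd_eq_inv {a : ℕ} (ha : 0 < a) :
    PowerSeries.mk (fun n => if a ∣ n then (1 : ℚ) else 0) = (1 - PowerSeries.X ^ a)⁻¹ := by
  rw [PowerSeries.eq_inv_iff_mul_eq_one (by simp [ha.ne'])]
  ext n
  rw [mul_sub, mul_one, map_sub, PowerSeries.coeff_mul_X_pow', PowerSeries.coeff_mk,
    PowerSeries.coeff_mk, PowerSeries.coeff_one]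
  by_cases hn : a ≤ n
  · have : a ∣ n - a ↔ a ∣ n := by
      rw [Nat.dvd_sub_iff_left hn dvd_rfl]
    simp only [hn, if_true, this, sub_self]
    rw [if_neg (by omega)]
  · rw [if_neg hn, sub_zero]
    rcases Nat.eq_zero_or_pos n with rfl | h
    · simp
    · rw [if_neg (Nat.not_dvd_of_pos_of_lt h (by omega)), if_neg h.ne']

theorem pHilbertSeries_eq_sum {p a d : ℕ} (ha : 3 ≤ a) (hd : 0 < d) (had : Nat.gcd a d = 1)
    (hp : p ≤ a / 2) :
    pHilbertSeries p ![a, a + d, a + 2 * d] =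
      (1 - PowerSeries.X ^ a)⁻¹ * ∑ r ∈ range a, PowerSeries.X ^ aperyElt p a d r := by
  rw [← mk_dvd_eq_inv (by omega : 0 < a), mul_sum]
  ext n
  rw [map_sum, pHilbertSeries, PowerSeries.coeff_mk]
  have h := indicator_pSemigroup ha hd had hp (fun _ => (1 : ℚ)) n
  classical
  rw [Set.indicator_apply] at h
  convert h using 2 with r
  rw [PowerSeries.coeff_mul_X_pow', PowerSeries.coeff_mk, ite_and]

theorem hasSum_pSemigroup {p a d : ℕ} (ha : 3 ≤ a) (hd : 0 < d) (had : Nat.gcd a d = 1)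
    (hp : p ≤ a / 2) {x : ℂ} (hx : ‖x‖ < 1) :
    HasSum (fun s : pSemigroup p ![a, a + d, a + 2 * d] => x ^ (s : ℕ))
      ((1 - x ^ a)⁻¹ * ∑ r ∈ range a, x ^ aperyElt p a d r) := by
  change HasSum ((fun n : ℕ => x ^ n) ∘ ((↑) : pSemigroup p ![a, a + d, a + 2 * d] → ℕ)) _
  rw [hasSum_subtype_iff_indicator, mul_sum,
    funext (indicator_pSemigroup ha hd had hp (fun n : ℕ => x ^ n))]
  refine hasSum_sum fun r _ => ?_
  have hinj : Function.Injective (fun k : ℕ => aperyElt p a d r + a * k) := by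
    intro k k' h
    exact Nat.eq_of_mul_eq_mul_left (by omega : 0 < a) (Nat.add_left_cancel h)
  rw [← hinj.hasSum_iff]
  · have hxa : ‖x ^ a‖ < 1 := by
      rw [norm_pow]
      exact pow_lt_one₀ (norm_nonneg _) hx (by omega)
    refine ((hasSum_geometric_of_norm_lt_one hxa).mul_right (x ^ aperyElt p a d r)).congr_fun ?_
    intro k
    simp [pow_add, pow_mul, mul_comm]
  · intro n hn
    refine if_neg fun ⟨h, k, hk⟩ => hn ⟨k, ?_⟩
    change aperyElt p a d r + a * k = n
    omega

/-! ### Summation over the Apéry set -/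

theorem geom_sum_eq_mul_of_mul_eq_one {R : Type*} [CommRing R] {y w : R} (h : (1 - y) * w = 1)
    (n : ℕ) : ∑ k ∈ range n, y ^ k = (1 - y ^ n) * w := by
  rw [← mul_neg_geom_sum y n, mul_right_comm, h, one_mul]

theorem sum_range_two_mul {M : Type*} [AddCommMonoid M] (f : ℕ → M) (n : ℕ) :
    ∑ r ∈ range (2 * n), f r = ∑ k ∈ range n, f (2 * k) + ∑ k ∈ range n, f (2 * k + 1) := by
  induction n with
  | zero => simp
  | succ n ih =>
    rw [show 2 * (n + 1) = 2 * n + 1 + 1 by ring, sum_range_succ, sum_range_succ, ih,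
      sum_range_succ, sum_range_succ]
    abel

theorem aperyElt_two_mul_add (p a d k : ℕ) :
    aperyElt p a d (2 * p + 2 * k) = 2 * p * (a + d) + (a + 2 * d) * k := by
  rw [aperyElt, aperyLevel, if_pos (by omega),
    show (2 * p + 2 * k + 1) / 2 = p + k by omega]
  ring

theorem aperyElt_two_mul_add_one (p a d k : ℕ) :
    aperyElt p a d (2 * p + (2 * k + 1)) = 2 * p * (a + d) + (a + d) + (a + 2 * d) * k := by
  rw [aperyElt, aperyLevel, if_pos (by omega),
    show (2 * p + (2 * k + 1) + 1) / 2 = p + k + 1 by omega]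
  ring

/-- For odd `a` the level is constant on `r < 2 * p`, so that part has ratio `x ^ d`. The inverses
`w`, `v` are abstract so as to cover power series and `ℂ` alike. -/
theorem sum_aperyElt_odd {R : Type*} [CommRing R] {p a d : ℕ} (hodd : Odd a)
    (hp : p ≤ a / 2) {x w v : R} (hw : (1 - x ^ d) * w = 1) (hv : (1 - x ^ (a + 2 * d)) * v = 1) :
    ∑ r ∈ range a, x ^ aperyElt p a d r =
      x ^ ((a - 1) / 2 * (a + 2 * d) + p * a + d) * (1 - x ^ (2 * p * d)) * w
        + x ^ (2 * p * (a + d)) *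
          (1 + x ^ (a + d) - x ^ (((a + 1) / 2 - p) * (a + 2 * d))
            - x ^ (a + d + ((a - 1) / 2 - p) * (a + 2 * d))) * v := by
  obtain ⟨b, rfl⟩ := hodd
  obtain ⟨q, rfl⟩ : ∃ q, b = p + q := ⟨b - p, by omega⟩
  rw [show (2 * (p + q) + 1 - 1) / 2 = p + q by omega,
    show (2 * (p + q) + 1 + 1) / 2 - p = q + 1 by omega, show p + q - p = q by omega]
  generalize ha : 2 * (p + q) + 1 = a at *
  have hlow : ∀ r ∈ range (2 * p), x ^ aperyElt p a d r =
      x ^ ((p + q) * (a + 2 * d) + p * a + d) * (x ^ d) ^ r := by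
    intro r hr
    rw [mem_range] at hr
    rw [aperyElt, aperyLevel, if_neg (by omega),
      show (r + a + 1) / 2 - r / 2 - 1 = p + q by omega, ← pow_mul, ← pow_add]
    congr 1
    subst ha
    ring
  rw [← ha, show 2 * (p + q) + 1 = 2 * p + 2 * q + 1 by ring, sum_range_succ, sum_range_add,
    sum_range_two_mul (fun r => x ^ aperyElt _ _ d (2 * p + r)),
    show 2 * p + 2 * q + 1 = a by omega, sum_congr rfl hlow, ← mul_sum,
    geom_sum_eq_mul_of_mul_eq_one hw]
  simp only [aperyElt_two_mul_add, aperyElt_two_mul_add_one, pow_add _ (2 * p * (a + d)),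
    pow_mul _ (a + 2 * d), pow_add _ (2 * p * (a + d) + (a + d)), ← mul_sum]
  rw [geom_sum_eq_mul_of_mul_eq_one hv]
  rw [pow_mul' x (q + 1), pow_add _ _ (q * _), pow_mul' x q, pow_mul' x (2 * p) d]
  -- Even offsets outnumber odd ones by one; `hv` absorbs the extra top term.
  linear_combination (-x ^ (2 * p * (a + d)) * (x ^ (a + 2 * d)) ^ q) * hv

/-- For even `a` the level on `r < 2 * p` depends on the parity of `r`, whence ratio `x ^ (2 * d)`
and the common factor `x ^ (a + d) + 1`. -/
theorem sum_aperyElt_even {R : Type*} [CommRing R] {p a d : ℕ} (heven : Even a) (ha0 : 0 < a)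
    (hp : p ≤ a / 2) {x w v : R} (hw : (1 - x ^ (2 * d)) * w = 1)
    (hv : (1 - x ^ (a + 2 * d)) * v = 1) :
    ∑ r ∈ range a, x ^ aperyElt p a d r =
      (x ^ (a + d) + 1) *
        (x ^ (a / 2 * (a + 2 * d) + p * a - a) * (1 - x ^ (2 * p * d)) * w
          + x ^ (2 * p * (a + d)) * (1 - x ^ ((a / 2 - p) * (a + 2 * d))) * v) := by
  obtain ⟨b, rfl⟩ := heven.two_dvd
  obtain ⟨q, rfl⟩ : ∃ q, b = p + q := ⟨b - p, by omega⟩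
  rw [show 2 * (p + q) / 2 = p + q by omega, show p + q - p = q by omega]
  generalize ha : 2 * (p + q) = a at *
  generalize hE : (p + q) * (a + 2 * d) + p * a - a = E
  -- The subtraction in the exponent does not truncate, even for `p = 0`.
  have hE' : E + a = (p + q) * (a + 2 * d) + p * a := by
    have : a ≤ (p + q) * (a + 2 * d) :=
      (Nat.le_add_right _ _).trans (Nat.le_mul_of_pos_left _ (by omega))
    omega
  have hlevel : a * (p + d + (p + q - 1)) = E := by
    obtain ⟨c, hc⟩ : ∃ c, p + q = c + 1 := ⟨p + q - 1, by omega⟩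
    rw [hc] at hE' ha ⊢
    rw [Nat.add_sub_cancel]
    apply Nat.add_right_cancel (m := a)
    rw [hE', ← ha]
    ring
  have hlow0 : ∀ k ∈ range p, x ^ aperyElt p a d (2 * k) = x ^ E * (x ^ (2 * d)) ^ k := by
    intro k hk
    rw [mem_range] at hk
    rw [aperyElt, aperyLevel, if_neg (by omega),
      show (2 * k + a + 1) / 2 - 2 * k / 2 - 1 = p + q - 1 by omega, hlevel, ← pow_mul, ← pow_add]
    congr 1
    ring
  have hlow1 : ∀ k ∈ range p, x ^ aperyElt p a d (2 * k + 1) =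
      x ^ (a + d) * x ^ E * (x ^ (2 * d)) ^ k := by
    intro k hk
    rw [mem_range] at hk
    rw [aperyElt, aperyLevel, if_neg (by omega),
      show (2 * k + 1 + a + 1) / 2 - (2 * k + 1) / 2 - 1 = p + q - 1 + 1 by omega,
      ← add_assoc (p + d), mul_add a, hlevel, ← pow_mul, ← pow_add, ← pow_add]
    congr 1
    ring
  rw [← ha, show 2 * (p + q) = 2 * p + 2 * q by ring, sum_range_add,
    sum_range_two_mul, sum_range_two_mul (fun r => x ^ aperyElt _ _ d (2 * p + r)),
    show 2 * p + 2 * q = a by omega, sum_congr rfl hlow0, sum_congr rfl hlow1, ← mul_sum,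
    ← mul_sum, geom_sum_eq_mul_of_mul_eq_one hw]
  simp only [aperyElt_two_mul_add, aperyElt_two_mul_add_one, pow_add _ (2 * p * (a + d)),
    pow_mul _ (a + 2 * d), pow_add _ (2 * p * (a + d) + (a + d)), ← mul_sum]
  rw [geom_sum_eq_mul_of_mul_eq_one hv, pow_mul' x q, show 2 * p * d = 2 * d * p by ring,
    pow_mul x (2 * d)]
  ring

theorem one_sub_pow_mul_inv {x : ℂ} (hx : ‖x‖ < 1) {m : ℕ} (hm : 0 < m) :
    (1 - x ^ m) * (1 - x ^ m)⁻¹ = 1 := by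
  refine mul_inv_cancel₀ (sub_ne_zero.mpr fun h => ?_)
  have := pow_lt_one₀ (norm_nonneg x) hx hm.ne'
  rw [← norm_pow, ← h, norm_one] at this
  exact lt_irrefl _ this

theorem proposition3 (p a d : ℕ) (ha : 3 ≤ a) (hd : 0 < d) (had : Nat.gcd a d = 1)
    (hp : p ≤ a / 2) :
    (Odd a →
      (∀ x : ℂ, ‖x‖ < 1 →
        HasSum (fun s : pSemigroup p ![a, a + d, a + 2 * d] => x ^ (s : ℕ))
          (1 / (1 - x ^ a) *
            (x ^ ((a - 1) / 2 * (a + 2 * d) + p * a + d) * (1 - x ^ (2 * p * d)) / (1 - x ^ d)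
              + x ^ (2 * p * (a + d)) *
                  (1 + x ^ (a + d) - x ^ (((a + 1) / 2 - p) * (a + 2 * d))
                    - x ^ (a + d + ((a - 1) / 2 - p) * (a + 2 * d)))
                  / (1 - x ^ (a + 2 * d))))) ∧
      pHilbertSeries p ![a, a + d, a + 2 * d] =
        (1 - PowerSeries.X ^ a)⁻¹ *
          (PowerSeries.X ^ ((a - 1) / 2 * (a + 2 * d) + p * a + d)
              * (1 - PowerSeries.X ^ (2 * p * d)) * (1 - PowerSeries.X ^ d)⁻¹
            + PowerSeries.X ^ (2 * p * (a + d)) *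
                (1 + PowerSeries.X ^ (a + d) - PowerSeries.X ^ (((a + 1) / 2 - p) * (a + 2 * d))
                  - PowerSeries.X ^ (a + d + ((a - 1) / 2 - p) * (a + 2 * d)))
                * (1 - PowerSeries.X ^ (a + 2 * d))⁻¹)) ∧
    (Even a →
      (∀ x : ℂ, ‖x‖ < 1 →
        HasSum (fun s : pSemigroup p ![a, a + d, a + 2 * d] => x ^ (s : ℕ))
          ((x ^ (a + d) + 1) / (1 - x ^ a) *
            (x ^ (a / 2 * (a + 2 * d) + p * a - a) * (1 - x ^ (2 * p * d)) / (1 - x ^ (2 * d))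
              + x ^ (2 * p * (a + d)) * (1 - x ^ ((a / 2 - p) * (a + 2 * d)))
                  / (1 - x ^ (a + 2 * d))))) ∧
      pHilbertSeries p ![a, a + d, a + 2 * d] =
        (PowerSeries.X ^ (a + d) + 1) * (1 - PowerSeries.X ^ a)⁻¹ *
          (PowerSeries.X ^ (a / 2 * (a + 2 * d) + p * a - a)
              * (1 - PowerSeries.X ^ (2 * p * d)) * (1 - PowerSeries.X ^ (2 * d))⁻¹
            + PowerSeries.X ^ (2 * p * (a + d))
                * (1 - PowerSeries.X ^ ((a / 2 - p) * (a + 2 * d)))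
                * (1 - PowerSeries.X ^ (a + 2 * d))⁻¹)) := by
  refine ⟨fun hodd => ⟨fun x hx => ?_, ?_⟩, fun heven => ⟨fun x hx => ?_, ?_⟩⟩
  · have h := hasSum_pSemigroup ha hd had hp hx
    rw [sum_aperyElt_odd hodd hp (one_sub_pow_mul_inv hx hd)
      (one_sub_pow_mul_inv hx (by omega : 0 < a + 2 * d))] at h
    simpa only [div_eq_mul_inv, one_mul] using h
  · rw [pHilbertSeries_eq_sum ha hd had hp, sum_aperyElt_odd hodd hp (one_sub_X_pow_mul_inv hd)
      (one_sub_X_pow_mul_inv (by omega : 0 < a + 2 * d))]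
  · have h := hasSum_pSemigroup ha hd had hp hx
    rw [sum_aperyElt_even heven (by omega) hp
      (one_sub_pow_mul_inv hx (by omega : 0 < 2 * d))
      (one_sub_pow_mul_inv hx (by omega : 0 < a + 2 * d)), ← mul_assoc,
      mul_comm (1 - x ^ a)⁻¹] at h
    simpa only [div_eq_mul_inv] using h
  · rw [pHilbertSeries_eq_sum ha hd had hp, sum_aperyElt_even heven (by omega) hp
      (one_sub_X_pow_mul_inv (by omega : 0 < 2 * d))
      (one_sub_X_pow_mul_inv (by omega : 0 < a + 2 * d)), ← mul_assoc,
      mul_comm (1 - PowerSeries.X ^ a)⁻¹]
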